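/- **Setting.** A network $\mathcal N=(\mathcal G,S,\rho)$ is a finite directed acyclic multigraph $\mathcal G=(\mathcal V,\mathcal E)$ with $s\ge 1$ distinct source nodes $\sigma_1,\dots,\sigma_s$ (set $S$) without input edges and a sink $\rho\notin S$ without output edges, such that every node other than $\rho$ has a directed path to $\rho$. For $C\subseteq\mathcal E$ let $D_C\subseteq S$ be the set of sources from which some edge of $C$ can be reached, and $I_C\subseteq S$ the set of sources that cannot reach $\rho$ after the edges of $C$ are deleted; let $C_{\min}=\min\{|C|: I_C\neq\emptyset\}$. For $U\subseteq \mathcal V$ and $W\subseteq\mathcal E$, a set $C\subseteq\mathcal E$ is a cut separating $W$ from $U$ if after deleting $C$ no path from a node of $U$ to an edge of $W$ remains (in particular edges of $W\cap C$ are deleted); $\operatorname{MINCUT}(U,W)$ is the set of cuts of minimum size and $\operatorname{mincut}(U,W)$ is that size. For an integer $r\ge 0$ let $\mathcal W_r=\{W\subseteq\mathcal E:|W|\le r\}$ and $\mathcal W_r^*=\{W\subseteq\mathcal E:|W|=\operatorname{mincut}(D_W,W)\le r\}$. Write $\alpha\sim^s\beta$ if $\operatorname{MINCUT}(D_\alpha,\alpha)\cap\operatorname{MINCUT}(D_\beta,\beta)\ne\emptyset$,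 and $\alpha\le\beta$ if $\alpha\in\operatorname{MINCUT}(D_\beta,\beta)$. Let $\widehat{\mathcal W}_r'$ be the set of those $W$ with $|W|=r$ that are the bottom (least element with respect to $\le$) of some equivalence class of $\mathcal W_r^*$ under $\sim^s$. Let $\mathbb F_q$ be a finite field with $q$ elements, $k\ge1$, $t\ge0$, $T\in\mathbb F_q^{s\times k}$, $\Upsilon\in\mathbb F_q^{s\times t}$, and $f(\vec m)=\vec m\,T$, $\zeta(\vec m)=\vec m\,\Upsilon$ for $\vec m\in\mathbb F_q^{s}$. An $\mathbb F_q$-valued $(\ell,n)$ linear secure network code consists of key lengths $z_i\ge 0$, matrices $A_{i,e}\in\mathbb F_q^{(\ell+z_i)\times n}$ for edges $e$ leaving $\sigma_i$, matrices $A_{d,e}\in\mathbb F_q^{n\times n}$ for an edge $e$ whose tail is not a source and each edge $d$ entering that tail, and a decoding map $\hat\varphi:\prod_{e\in \mathrm{In}(\rho)}\mathbb F_q^n\to(\mathbb F_q^{k})^{\ell}$. For messages $\mathbf m_i\in\mathbb F_q^\ell$ and keys $\mathbf k_i\in\mathbb F_q^{z_i}$, the symbols $y_e\in\mathbb F_q^n$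 are defined recursively by $y_e=(\mathbf m_i\ \mathbf k_i)A_{i,e}$ if $e$ leaves $\sigma_i$ and $y_e=\sum_{d\in \mathrm{In}(\mathrm{tail}(e))}y_dA_{d,e}$ otherwise. The code is admissible for $(\mathcal N,f,\mathcal W_r,\zeta)$ if 1. for all messages and keys, $\hat\varphi(y_e:e\in\mathrm{In}(\rho))$ equals the $\ell$ values $f(m_{1,j},\dots,m_{s,j})$, $1\le j\le\ell$; and 2. when all messages and keys are independent and uniformly distributed, $I\big(Y_W;\zeta(\mathbf M_S)\big)=0$ for every $W\in\mathcal W_r$, where $Y_W=(Y_e:e\in W)$ and $\zeta(\mathbf M_S)=(\zeta(M_{1,j},\dots,M_{s,j}))_{1\le j\le\ell}$. **Theorem.** For all integers $r,R\ge0$ with $rk\le R\le C_{\min}$, if $$q> s\cdot|\widehat{\mathcal W}_r'|,$$ then there exists an $\mathbb F_q$-valued admissible $(R-rk,k)$ linear secure network code for $(\mathcal N,f,\mathcal W_r,\zeta)$. -/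

import Mathlib

/-- A network: a finite directed acyclic multigraph with node type `V` and edge type `E`,
together with `s` distinct source nodes without input edges and one sink node without output
edges, such that every other node has a directed path to the sink. -/
structure Network (V E : Type*) (s : ℕ) where
  tail : E → V
  head : E → V
  /-- there is no directed cycle of edges -/
  acyclic : ∀ e, ¬ Relation.TransGen (fun a b => head a = tail b) e e
  source : Fin s → V
  source_injective : Function.Injective source
  sink : V
  source_ne_sink : ∀ i, source i ≠ sink
  head_ne_source : ∀ e i, head e ≠ source i
  tail_ne_sink : ∀ e, tail e ≠ sink
  reaches_sink : ∀ u, u ≠ sink → ∃ d e, tail d = u ∧ head e = sink ∧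
    Relation.ReflTransGen (fun a b => head a = tail b) d e

namespace Network

variable {V E : Type*} {s : ℕ} (N : Network V E s)

/-- After deleting the edges in `C`, there is a directed path from the node `u` to the edge `e`:
a sequence of remaining edges, the first one leaving `u`, the last one being `e`. -/
def NodeToEdge (C : Finset E) (u : V) (e : E) : Prop :=
  ∃ d, N.tail d = u ∧ d ∉ C ∧
    Relation.ReflTransGen (fun a b => N.head a = N.tail b ∧ b ∉ C) d e

/-- After deleting the edges in `C`, there is a directed path from the node `u` to the node `v`. -/
def NodeToNode (C : Finset E) (u v : V) : Prop :=
  ∃ e, N.head e = v ∧ N.NodeToEdge C u e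

/-- `D_C`: the source nodes from which some edge of `C` can be reached. -/
def D (C : Finset E) : Set V :=
  {v | (∃ i, N.source i = v) ∧ ∃ e ∈ C, N.NodeToEdge ∅ v e}

/-- `I_C`: the source nodes that cannot reach the sink once the edges in `C` are deleted. -/
def I (C : Finset E) : Set V :=
  {v | (∃ i, N.source i = v) ∧ ¬ N.NodeToNode C v N.sink}

/-- `Λ(N)`: the family of all cut sets. -/
def cutSets : Set (Finset E) := {C | (N.I C).Nonempty}

/-- `C_min`: the minimum size of a cut set. -/
noncomputable def cMin : ℕ := sInf (Finset.card '' N.cutSets)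

/-- `C` is a cut separating the edge set `W` from the node set `U`. -/
def IsCut (U : Set V) (W C : Finset E) : Prop :=
  ∀ u ∈ U, ∀ e ∈ W, ¬ N.NodeToEdge C u e

/-- `C ∈ MINCUT(U, W)`. -/
def IsMinCut (U : Set V) (W C : Finset E) : Prop :=
  N.IsCut U W C ∧ ∀ C', N.IsCut U W C' → C.card ≤ C'.card

/-- `mincut(U, W)`. -/
noncomputable def mincut (U : Set V) (W : Finset E) : ℕ :=
  sInf (Finset.card '' {C | N.IsCut U W C})

/-- The relation `α ∼ˢ β`: some edge set is a common minimum cut separating `α` from `D_α` and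
`β` from `D_β`. -/
def Sim (α β : Finset E) : Prop :=
  ∃ ξ, N.IsMinCut (N.D α) α ξ ∧ N.IsMinCut (N.D β) β ξ

/-- The relation `α ≤ β`: `α ∈ MINCUT(D_β, β)`. -/
def Le (α β : Finset E) : Prop := N.IsMinCut (N.D β) β α

/-- `W_r`: the edge sets with at most `r` elements. -/
def wiretapSets (_N : Network V E s) (r : ℕ) : Set (Finset E) := {W | W.card ≤ r}

/-- `W_r^*`: the edge sets `W` with `|W| = mincut(D_W, W) ≤ r`. -/
def wStar (r : ℕ) : Set (Finset E) := {W | W.card = N.mincut (N.D W) W ∧ W.card ≤ r}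

/-- The equivalence class of `W` in `W_r^*` under `∼ˢ`. -/
def simClass (r : ℕ) (W : Finset E) : Set (Finset E) := {W' | W' ∈ N.wStar r ∧ N.Sim W W'}

/-- The set of the bottom elements of all equivalence classes of `W_r^*` under `∼ˢ`. -/
def wBottom (r : ℕ) : Set (Finset E) :=
  {B | ∃ W ∈ N.wStar r, B ∈ N.simClass r W ∧ ∀ W' ∈ N.simClass r W, N.Le B W'}

/-- The set of those bottom elements that have exactly `r` edges. -/
def wBottomExact (r : ℕ) : Set (Finset E) := {B | B ∈ N.wBottom r ∧ B.card = r}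

theorem wellFounded_edges [Finite E] : WellFounded (fun d e => N.head d = N.tail e) := by
  have h : WellFounded (Relation.TransGen (fun d e => N.head d = N.tail e)) := by
    have : IsTrans E (Relation.TransGen (fun d e => N.head d = N.tail e)) :=
      ⟨fun _ _ _ => Relation.TransGen.trans⟩
    have : Std.Irrefl (Relation.TransGen (fun d e => N.head d = N.tail e)) := ⟨N.acyclic⟩
    exact Finite.wellFounded_of_trans_of_irrefl _
  exact Subrelation.wf (r := Relation.TransGen (fun d e => N.head d = N.tail e))
    (fun {_ _} hab => Relation.TransGen.single hab) h

end Network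

/-- Shannon entropy (in nats) of a distribution on a finite set. -/
noncomputable def shannonEntropy {α : Type*} [Fintype α] (p : PMF α) : ℝ :=
  ∑ a, Real.negMulLog (p a).toReal

/-- Mutual information `I(X; Y) = H(X) + H(Y) - H(X, Y)` of two random variables with finitely
many values, on the probability space given by `p`. -/
noncomputable def mutualInfo {Ω α β : Type*} [Fintype α] [Fintype β] (p : PMF Ω)
    (X : Ω → α) (Y : Ω → β) : ℝ :=
  shannonEntropy (p.map X) + shannonEntropy (p.map Y) - shannonEntropy (p.map fun ω => (X ω, Y ω))

/-- An `(ℓ, n)` linear secure network code over `F` on the network `N`, for a target function with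
values in `O`. The source node `i` holds a message in `F ^ ℓ` and a key in `F ^ (keyLen i)`; the
matrix `srcMat i e` is used only for the edges `e` leaving the source node `i`, the matrix
`intMat d e` only for the edges `d` entering the (non-source) tail of `e`. -/
structure LinearSecureCode {V E : Type*} {s : ℕ} (N : Network V E s) (F O : Type*) (ℓ n : ℕ) where
  keyLen : Fin s → ℕ
  srcMat : (i : Fin s) → E → Matrix (Fin ℓ ⊕ Fin (keyLen i)) (Fin n) F
  intMat : E → E → Matrix (Fin n) (Fin n) F
  decode : ({e : E // N.head e = N.sink} → Fin n → F) → Fin ℓ → O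

namespace LinearSecureCode

variable {V E : Type*} {s : ℕ} {N : Network V E s} {F O : Type*} {ℓ n : ℕ}
  (c : LinearSecureCode N F O ℓ n)

/-- Joint realizations `(m_S, k_S)` of the source messages and of the keys. -/
abbrev Realization : Type _ := (Fin s → Fin ℓ → F) × ((i : Fin s) → Fin (c.keyLen i) → F)

open Classical in
/-- The message `y_e = ĝ_e(m_S, k_S)` transmitted on the edge `e`, by recursion along the
acyclic graph. -/
noncomputable def globalEnc [Field F] [Fintype E] (x : c.Realization) : E → Fin n → F :=
  N.wellFounded_edges.fix fun e y =>
    if h : ∃ i, N.tail e = N.source i then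
      Matrix.vecMul (Sum.elim (x.1 h.choose) (x.2 h.choose)) (c.srcMat h.choose e)
    else ∑ d : {d : E // N.head d = N.tail e}, Matrix.vecMul (y d.1 d.2) (c.intMat d.1 e)

theorem globalEnc_of_source [Field F] [Fintype E] (x : c.Realization) (e : E) (i : Fin s)
    (h : N.tail e = N.source i) :
    c.globalEnc x e = Matrix.vecMul (Sum.elim (x.1 i) (x.2 i)) (c.srcMat i e) := by
  have h' : ∃ i, N.tail e = N.source i := ⟨i, h⟩
  have hi : h'.choose = i := N.source_injective (h'.choose_spec.symm.trans h)
  unfold globalEnc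
  rw [WellFounded.fix_eq, dif_pos h', hi]

open Classical in
theorem globalEnc_of_not_source [Field F] [Fintype E] (x : c.Realization) (e : E)
    (h : ∀ i, N.tail e ≠ N.source i) :
    c.globalEnc x e = ∑ d : {d : E // N.head d = N.tail e},
      Matrix.vecMul (c.globalEnc x d.1) (c.intMat d.1 e) := by
  have h' : ¬ ∃ i, N.tail e = N.source i := fun ⟨i, hi⟩ => h i hi
  unfold globalEnc
  rw [WellFounded.fix_eq, dif_neg h']

/-- Computability condition: the sink computes the `ℓ` values of `f` with zero error. -/
def Computes [Field F] [Fintype E] (f : (Fin s → F) → O) : Prop :=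
  ∀ x : c.Realization,
    c.decode (fun e => c.globalEnc x e.1) = fun j => f (fun i => x.1 i j)

open Classical in
/-- Security condition `I(Y_W; ζ(M_S)) = 0` for every wiretap set `W`. The source messages and
the keys are independent and uniformly distributed, so `(M_S, K_S)` is uniform on all
realizations. -/
def IsSecure [Field F] [Fintype F] [Fintype E] {Q : Type*} [Fintype Q] (𝒲 : Set (Finset E))
    (ζ : (Fin s → F) → Q) : Prop :=
  ∀ W ∈ 𝒲, mutualInfo (PMF.uniformOfFintype c.Realization)
    (fun x (e : {e : E // e ∈ W}) => c.globalEnc x e.1)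
    (fun x (j : Fin ℓ) => ζ (fun i => x.1 i j)) = 0

/-- The code is admissible for the secure model `(N, f, 𝒲, ζ)`. -/
def Admissible [Field F] [Fintype F] [Fintype E] {Q : Type*} [Fintype Q]
    (f : (Fin s → F) → O) (𝒲 : Set (Finset E)) (ζ : (Fin s → F) → Q) : Prop :=
  c.Computes f ∧ c.IsSecure 𝒲 ζ

end LinearSecureCode

/-! ### Linear algebra: a common supplement for few subspaces. -/

section LinearAlgebra

variable {F V ι : Type*} [Field F] [AddCommGroup V] [Module F V]

/-! The code runs one scalar network code for sums `k` times, once per column of `T`. At least `R`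
edges are needed to cut any source from the sink, so for `q > s` the reversed network carries a
linear multicast of `F ^ R` from the sink to all sources (`Network.exists_multicast`). This gives
edge vectors `h e` and local coefficients `L`. If the transposed coefficients are run forwards, the
combination `∑ y e • h e` is the same at the sink as at the sources
(`Network.sum_smul_sink_eq_sum_smul_source`). Hence the sink recovers `∑ i, T i j • x i` from source
inputs `x i`. In a common basis, each `x i` consists of `R - r * k` message coordinates and `r * k`
key coordinates.

For security, the same `x i` serves every column, so all symbols on an edge `e` depend on `x i` only
through one scalar `x i ⬝ᵥ g i e`. Thus `r` edges impose only `r` linear conditions on each `x i`.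
If the key vectors together with the solution space `G` of these conditions span everything, every
message has a key that puts `x i` in `G`, and shifting the key by it hides the message. Each wiretap
set lies behind a bottom element with `r` edges (`Network.exists_mem_wBottomExact`), and scalars
vanishing on that cut vanish beyond it. So only `s * (N.wBottomExact r).ncard` subspaces matter, and
fewer than `q` subspaces of codimension at most `r` have a common supplement. -/

theorem Submodule.exists_mem_forall_notMem [Fintype F] [Finite ι] (W : Submodule F V)
    (U : ι → Submodule F V) (hU : ∀ i, ¬ W ≤ U i) (hι : Nat.card ι < Fintype.card F) :
    ∃ v ∈ W, ∀ i, v ∉ U i := by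
  have := Fintype.ofFinite ι
  have h := Submodule.iUnion_ssubset_of_forall_ne_top_of_card_lt Finset.univ
    (fun i => (U i).comap W.subtype) (fun i hi => hU i (Submodule.comap_subtype_eq_top.1 hi))
    (by simpa [ENat.card_eq_coe_fintype_card] using hι)
  obtain ⟨v, -, hv⟩ := Set.exists_of_ssubset h
  exact ⟨v, v.2, fun i hi => hv (by simpa using ⟨i, hi⟩)⟩

/-- A subspace of dimension at most `r` which is a supplement of few subspaces of codimension at
most `r`. -/
theorem Submodule.exists_finrank_le_forall_sup_eq_top [Fintype F] [Finite ι]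
    [FiniteDimensional F V] (hι : Nat.card ι < Fintype.card F) (r : ℕ) :
    ∀ G : ι → Submodule F V, (∀ j, Module.finrank F V ≤ Module.finrank F (G j) + r) →
      ∃ K : Submodule F V, Module.finrank F K ≤ r ∧ ∀ j, K ⊔ G j = ⊤ := by
  induction r with
  | zero =>
    intro G hG
    refine ⟨⊥, by simp, fun j => ?_⟩
    rw [bot_sup_eq]
    exact Submodule.eq_top_of_finrank_eq (le_antisymm (Submodule.finrank_le _) (hG j))
  | succ r ih =>
    intro G hG
    -- A single vector outside all the proper `G j` lowers each of their codimensions by one, so `r`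
    -- vectors suffice for all of them.
    obtain ⟨v, -, hv⟩ := Submodule.exists_mem_forall_notMem ⊤
      (fun j : {j // G j ≠ ⊤} => G j) (fun j hj => j.2 (top_le_iff.1 hj))
      ((Finite.card_subtype_le _).trans_lt hι)
    obtain ⟨K, hK, hKG⟩ := ih (fun j => Submodule.span F {v} ⊔ G j) (fun j => by
      by_cases hj : G j = ⊤
      · rw [hj, sup_top_eq, finrank_top]
        omega
      · have hlt : G j < Submodule.span F {v} ⊔ G j :=
          right_lt_sup.2 fun h => hv ⟨j, hj⟩ (h (Submodule.mem_span_singleton_self v))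
        have := Submodule.finrank_lt_finrank_of_lt hlt
        have := hG j
        omega)
    refine ⟨K ⊔ Submodule.span F {v}, ?_, fun j => by rw [sup_assoc, hKG]⟩
    have h1 := Submodule.finrank_add_le_finrank_add_finrank K (Submodule.span F {v})
    have h2 : Module.finrank F (Submodule.span F {v}) ≤ 1 := by
      simpa using finrank_span_le_card (R := F) ({v} : Set V)
    omega

theorem Submodule.exists_le_finrank_eq [FiniteDimensional F V] (K : Submodule F V) {n : ℕ}
    (h1 : Module.finrank F K ≤ n) (h2 : n ≤ Module.finrank F V) :
    ∃ K', K ≤ K' ∧ Module.finrank F K' = n := by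
  induction n, h1 using Nat.le_induction with
  | base => exact ⟨K, le_rfl, rfl⟩
  | succ n hn ih =>
    obtain ⟨L, hKL, hL⟩ := ih (by omega)
    have hne : ∃ v, v ∉ L := by
      by_contra! h
      rw [(Submodule.eq_top_iff'.2 h), finrank_top] at hL
      omega
    obtain ⟨v, hv⟩ := hne
    refine ⟨L ⊔ Submodule.span F {v}, hKL.trans le_sup_left, ?_⟩
    have h3 := Submodule.finrank_lt_finrank_of_lt
      (left_lt_sup.2 fun h => hv (h (Submodule.mem_span_singleton_self v)) :
        L < L ⊔ Submodule.span F {v})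
    have h4 := Submodule.finrank_add_le_finrank_add_finrank L (Submodule.span F {v})
    have h5 : Module.finrank F (Submodule.span F {v}) ≤ 1 := by
      simpa using finrank_span_le_card (R := F) ({v} : Set V)
    omega

/-- A basis whose last vectors span a supplement of few subspaces of small
codimension. -/
theorem exists_basis_forall_span_sup_eq_top [Fintype F] [Finite ι]
    [FiniteDimensional F V] (hι : Nat.card ι < Fintype.card F) {r l m : ℕ}
    (hV : Module.finrank F V = l + m) (hr : r ≤ m) (G : ι → Submodule F V)
    (hG : ∀ j, Module.finrank F V ≤ Module.finrank F (G j) + r) :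
    ∃ b : Module.Basis (Fin l ⊕ Fin m) F V,
      ∀ j, Submodule.span F (Set.range fun u => b (Sum.inr u)) ⊔ G j = ⊤ := by
  obtain ⟨K₀, hK₀, hKG⟩ := Submodule.exists_finrank_le_forall_sup_eq_top hι r G hG
  obtain ⟨K, hle, hK⟩ := K₀.exists_le_finrank_eq (hK₀.trans hr) (by omega)
  obtain ⟨L, hLK⟩ := K.exists_isCompl
  have hL : Module.finrank F L = l := by
    have := Submodule.finrank_add_eq_of_isCompl hLK
    omega
  let bK := Module.finBasisOfFinrankEq F K hK
  let bL := Module.finBasisOfFinrankEq F L hL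
  refine ⟨(bL.prod bK).map (Submodule.prodEquivOfIsCompl L K hLK.symm), fun j => ?_⟩
  have : (Set.range fun u => ((bL.prod bK).map (Submodule.prodEquivOfIsCompl L K hLK.symm))
      (Sum.inr u)) = K.subtype '' Set.range bK := by
    rw [← Set.range_comp]
    congr 1
    ext u
    simp
  rw [this, Submodule.span_image, bK.span_eq, Submodule.map_top, Submodule.range_subtype,
    eq_top_iff, ← hKG j]
  exact sup_le_sup_right hle _

end LinearAlgebra

/-! ### Cuts and bottom elements. -/

namespace Network

variable {V E : Type*} {s : ℕ} (N : Network V E s)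

theorem NodeToEdge.of_subset {N : Network V E s} {C C' : Finset E} (h : C ⊆ C') {u : V} {e : E}
    (hp : N.NodeToEdge C' u e) : N.NodeToEdge C u e := by
  obtain ⟨d, hd, hdC, hde⟩ := hp
  exact ⟨d, hd, fun hc => hdC (h hc), hde.lift id fun a b hab => ⟨hab.1, fun hc => hab.2 (h hc)⟩⟩

theorem NodeToEdge.notMem {N : Network V E s} {C : Finset E} {u : V} {e : E}
    (hp : N.NodeToEdge C u e) : e ∉ C := by
  obtain ⟨d, hd, hdC, hde⟩ := hp
  rcases Relation.ReflTransGen.cases_tail hde with rfl | ⟨c, -, hc⟩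
  · exact hdC
  · exact hc.2

theorem NodeToEdge.step {N : Network V E s} {C : Finset E} {u : V} {d e : E}
    (hp : N.NodeToEdge C u d) (h : N.head d = N.tail e) (he : e ∉ C) : N.NodeToEdge C u e := by
  obtain ⟨d', hd, hdC, hde⟩ := hp
  exact ⟨d', hd, hdC, hde.tail ⟨h, he⟩⟩

/-- The edges of `Z` that leave a source node or follow an edge outside of `Z`. -/
noncomputable def entry [Fintype E] (Z : Finset E) : Finset E := by
  classical
  exact Z.filter fun e => (∃ i, N.source i = N.tail e) ∨ ∃ d, d ∉ Z ∧ N.head d = N.tail e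

theorem mem_entry [Fintype E] {Z : Finset E} {e : E} :
    e ∈ N.entry Z ↔
      e ∈ Z ∧ ((∃ i, N.source i = N.tail e) ∨ ∃ d, d ∉ Z ∧ N.head d = N.tail e) := by
  classical
  simp [entry]

theorem entry_subset [Fintype E] (Z : Finset E) : N.entry Z ⊆ Z :=
  fun _ he => ((N.mem_entry).1 he).1

/-- The first edge of `Z` on a path from a source lies in `entry Z`. So cuts can be studied through
the sets `Z` that they shield. -/
theorem not_nodeToEdge_entry [Fintype E] (Z : Finset E) (i : Fin s) {e : E} (he : e ∈ Z) :
    ¬ N.NodeToEdge (N.entry Z) (N.source i) e := by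
  rintro ⟨d, hd, hdC, hde⟩
  have : ∀ e, Relation.ReflTransGen (fun a b => N.head a = N.tail b ∧ b ∉ N.entry Z) d e →
      e ∉ Z := by
    intro e h
    induction h with
    | refl => exact fun hZ => hdC ((N.mem_entry).2 ⟨hZ, Or.inl ⟨i, hd.symm⟩⟩)
    | tail _ hbc ih => exact fun hZ => hbc.2 ((N.mem_entry).2 ⟨hZ, Or.inr ⟨_, ih, hbc.1⟩⟩)
  exact this e hde he

/-- The edges that no source node reaches once the edges in `C` are deleted. -/
noncomputable def shadow [Fintype E] (C : Finset E) : Finset E := by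
  classical
  exact Finset.univ.filter fun e => ∀ i, ¬ N.NodeToEdge C (N.source i) e

theorem mem_shadow [Fintype E] {C : Finset E} {e : E} :
    e ∈ N.shadow C ↔ ∀ i, ¬ N.NodeToEdge C (N.source i) e := by
  classical
  simp [shadow]

theorem entry_shadow_subset [Fintype E] (C : Finset E) : N.entry (N.shadow C) ⊆ C := by
  intro e he
  obtain ⟨he, h⟩ := (N.mem_entry).1 he
  rw [mem_shadow] at he
  by_contra hC
  rcases h with ⟨i, hi⟩ | ⟨d, hd, hde⟩
  · exact he i ⟨e, hi.symm, hC, .refl⟩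
  · rw [mem_shadow] at hd
    push Not at hd
    obtain ⟨i, hi⟩ := hd
    exact he i (hi.step hde hC)

theorem isCut_D_iff {W C : Finset E} :
    N.IsCut (N.D W) W C ↔ ∀ i, ∀ e ∈ W, ¬ N.NodeToEdge C (N.source i) e := by
  constructor
  · intro h i e he hp
    exact h _ ⟨⟨i, rfl⟩, e, he, hp.of_subset (Finset.empty_subset _)⟩ e he hp
  · rintro h _ ⟨⟨i, rfl⟩, -⟩ e he
    exact h i e he

theorem isCut_D_iff_subset_shadow [Fintype E] {W C : Finset E} :
    N.IsCut (N.D W) W C ↔ W ⊆ N.shadow C := by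
  rw [isCut_D_iff]
  constructor
  · exact fun h e he => (N.mem_shadow).2 fun i => h i e he
  · exact fun h i e he => (N.mem_shadow).1 (h he) i

theorem IsMinCut.mincut_eq {N : Network V E s} {U : Set V} {W C : Finset E}
    (h : N.IsMinCut U W C) : N.mincut U W = C.card := by
  refine le_antisymm (Nat.sInf_le ⟨C, h.1, rfl⟩) ?_
  refine le_csInf ⟨_, C, h.1, rfl⟩ ?_
  rintro _ ⟨C', hC', rfl⟩
  exact h.2 C' hC'

/-- A set equivalent to `B` shares a minimum cut with it, and by uniqueness this cut is `B`. -/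
theorem mem_wBottom_of_unique_minCut {r : ℕ} {B : Finset E} (hB : N.IsMinCut (N.D B) B B)
    (huniq : ∀ ξ, N.IsMinCut (N.D B) B ξ → ξ = B) (hr : B.card ≤ r) : B ∈ N.wBottom r := by
  have hmem : B ∈ N.wStar r := ⟨hB.mincut_eq.symm, hr⟩
  refine ⟨B, hmem, ⟨hmem, B, hB, hB⟩, ?_⟩
  rintro W' ⟨-, ξ, hξ, hξ'⟩
  obtain rfl := huniq ξ hξ
  exact hξ'

/-- `entry univ` is the set of edges leaving the sources; deleting it isolates every source. -/
theorem cMin_le_card_entry_univ [Fintype E] (hs : 0 < s) :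
    N.cMin ≤ (N.entry Finset.univ).card := by
  refine Nat.sInf_le ⟨_, ⟨N.source ⟨0, hs⟩, ⟨_, rfl⟩, ?_⟩, rfl⟩
  rintro ⟨e, -, he⟩
  exact N.not_nodeToEdge_entry _ _ (Finset.mem_univ e) he

/-- Every wiretap set is separated from the sources by a bottom element with `r` edges. -/
theorem exists_mem_wBottomExact [Fintype E] (hs : 0 < s) {r : ℕ} (hr : r ≤ N.cMin) {W : Finset E}
    (hW : W.card ≤ r) :
    ∃ B ∈ N.wBottomExact r, ∀ i, ∀ e ∈ W, ¬ N.NodeToEdge B (N.source i) e := by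
  classical
  -- The bottom element will be `entry Z` for a maximal shielded set `Z`. One more edge enlarges the
  -- entry by at most one, and `univ` has entry at least `cMin ≥ r`, so the bound `r` is attained.
  obtain ⟨Z, hWZ, hZmax⟩ := (Set.toFinite {Z : Finset E | (N.entry Z).card ≤ r}).exists_le_maximal
    (show W ∈ _ from (Finset.card_le_card (N.entry_subset W)).trans hW)
  have hZr : (N.entry Z).card ≤ r := hZmax.1
  have hcard : (N.entry Z).card = r := by
    refine le_antisymm hZr (le_of_not_gt fun hlt => ?_)
    by_cases hZ : Z = Finset.univ
    · have := N.cMin_le_card_entry_univ hs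
      rw [← hZ] at this
      omega
    · obtain ⟨e, he⟩ : ∃ e, e ∉ Z := by
        by_contra! h
        exact hZ (Finset.eq_univ_iff_forall.2 h)
      have hsub : N.entry (insert e Z) ⊆ insert e (N.entry Z) := by
        intro x hx
        obtain ⟨hx, h⟩ := (N.mem_entry).1 hx
        rw [Finset.mem_insert] at hx ⊢
        refine hx.imp id fun hx => (N.mem_entry).2 ⟨hx, h.imp id ?_⟩
        rintro ⟨d, hd, hde⟩
        exact ⟨d, fun h => hd (Finset.mem_insert_of_mem h), hde⟩
      have h1 := (Finset.card_le_card hsub).trans (Finset.card_insert_le _ _)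
      exact he (hZmax.2 (show insert e Z ∈ {Z : Finset E | (N.entry Z).card ≤ r} from
        h1.trans hlt) (Finset.subset_insert _ _) (Finset.mem_insert_self _ _))
  -- `Z ∪ Z'` can be entered only through `entry Z'`, so maximality forces `Z ∪ Z' = Z`.
  have key : ∀ Z', N.entry Z ⊆ Z' → (N.entry Z').card ≤ r → N.entry Z ⊆ N.entry Z' := by
    intro Z' hsub hZ'
    have hun : N.entry (Z ∪ Z') ⊆ N.entry Z' := by
      intro x hx
      obtain ⟨hx, h⟩ := (N.mem_entry).1 hx
      have hxZ' : x ∈ Z' := by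
        rcases Finset.mem_union.1 hx with hx | hx
        · refine hsub ((N.mem_entry).2 ⟨hx, h.imp id ?_⟩)
          rintro ⟨d, hd, hde⟩
          exact ⟨d, fun h => hd (Finset.mem_union_left _ h), hde⟩
        · exact hx
      refine (N.mem_entry).2 ⟨hxZ', h.imp id ?_⟩
      rintro ⟨d, hd, hde⟩
      exact ⟨d, fun h => hd (Finset.mem_union_right _ h), hde⟩
    have hle : Z ∪ Z' ⊆ Z := hZmax.2
      (show Z ∪ Z' ∈ {Z : Finset E | (N.entry Z).card ≤ r} from
        (Finset.card_le_card hun).trans hZ') Finset.subset_union_left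
    rwa [Finset.Subset.antisymm hle Finset.subset_union_left] at hun
  -- Here `key` is applied to the shadow of `ξ`, whose entry lies in `ξ`. This gives both minimality
  -- and uniqueness of the cut.
  have key' : ∀ ξ, N.IsCut (N.D (N.entry Z)) (N.entry Z) ξ → ξ.card ≤ r → N.entry Z = ξ := by
    intro ξ hξ hξr
    have hsub := N.entry_shadow_subset ξ
    have h := (key _ ((N.isCut_D_iff_subset_shadow).1 hξ)
      ((Finset.card_le_card hsub).trans hξr)).trans hsub
    exact Finset.eq_of_subset_of_card_le h (hcard ▸ hξr)
  have hmin : N.IsMinCut (N.D (N.entry Z)) (N.entry Z) (N.entry Z) := by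
    refine ⟨(N.isCut_D_iff).2 fun i e he hp => hp.notMem he, fun C hC => ?_⟩
    by_contra! hlt
    rw [← key' C hC (by omega)] at hlt
    exact lt_irrefl _ hlt
  refine ⟨N.entry Z, ⟨N.mem_wBottom_of_unique_minCut hmin (fun ξ hξ => ?_) hZr, hcard⟩,
    fun i e he => N.not_nodeToEdge_entry Z i (hWZ he)⟩
  exact (key' ξ hξ.1 ((hξ.2 _ hmin.1).trans hZr)).symm

end Network

/-! ### Linear multicast in the reversed network. -/

namespace Network

variable {V E : Type*} {s : ℕ} (N : Network V E s)

theorem wellFounded_edges_flip [Finite E] :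
    WellFounded (fun d e => N.head e = N.tail d) := by
  have h : WellFounded (Relation.TransGen (fun d e => N.head e = N.tail d)) := by
    have : IsTrans E (Relation.TransGen (fun d e => N.head e = N.tail d)) :=
      ⟨fun _ _ _ => Relation.TransGen.trans⟩
    have : Std.Irrefl (Relation.TransGen (fun d e => N.head e = N.tail d)) :=
      ⟨fun e he => N.acyclic e (Relation.transGen_swap.1 he)⟩
    exact Finite.wellFounded_of_trans_of_irrefl _
  exact Subrelation.wf (r := Relation.TransGen (fun d e => N.head e = N.tail d))
    (fun {_ _} hab => Relation.TransGen.single hab) h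

/-- The edges outside of `P` that leave the node set `Z`. -/
noncomputable def crossing [Fintype E] (P : Finset E) (Z : Set V) : Finset E := by
  classical
  exact Finset.univ.filter fun e => e ∉ P ∧ N.tail e ∈ Z ∧ N.head e ∉ Z

theorem mem_crossing [Fintype E] {P : Finset E} {Z : Set V} {e : E} :
    e ∈ N.crossing P Z ↔ e ∉ P ∧ N.tail e ∈ Z ∧ N.head e ∉ Z := by
  classical
  simp [crossing]

theorem card_crossing_union_add_inter_le [Fintype E] (P : Finset E) (Z₁ Z₂ : Set V) :
    (N.crossing P (Z₁ ∪ Z₂)).card + (N.crossing P (Z₁ ∩ Z₂)).card ≤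
      (N.crossing P Z₁).card + (N.crossing P Z₂).card := by
  classical
  rw [← Finset.card_union_add_card_inter, ← Finset.card_union_add_card_inter (N.crossing P Z₁)]
  refine Nat.add_le_add (Finset.card_le_card fun e => ?_) (Finset.card_le_card fun e => ?_) <;>
  · simp only [Finset.mem_union, Finset.mem_inter, mem_crossing, Set.mem_union, Set.mem_inter_iff]
    tauto

theorem cMin_le_card_crossing [Fintype E] {i : Fin s} {Z : Set V} (hi : N.source i ∈ Z)
    (hZ : N.sink ∉ Z) : N.cMin ≤ (N.crossing ∅ Z).card := by
  refine Nat.sInf_le ⟨_, ⟨N.source i, ⟨i, rfl⟩, ?_⟩, rfl⟩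
  rintro ⟨e, he, d, hd, hdC, hde⟩
  have key : ∀ e, Relation.ReflTransGen
      (fun a b => N.head a = N.tail b ∧ b ∉ N.crossing ∅ Z) d e → N.head e ∈ Z := by
    intro e h
    induction h with
    | refl =>
      by_contra hn
      exact hdC (N.mem_crossing.2 ⟨Finset.notMem_empty _, hd ▸ hi, hn⟩)
    | tail _ hbc ih =>
      by_contra hn
      exact hbc.2 (N.mem_crossing.2 ⟨Finset.notMem_empty _, hbc.1 ▸ ih, hn⟩)
  exact hZ (he ▸ key e hde)

section Multicast

variable {F M : Type*} [Field F] [AddCommGroup M] [Module F M]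

/-- The span of the vectors of those edges in `P` that start in `Z`. -/
def spanFrom (h : E → M) (P : Finset E) (Z : Set V) : Submodule F M :=
  Submodule.span F (h '' {p | p ∈ P ∧ N.tail p ∈ Z})

theorem spanFrom_union (h : E → M) (P : Finset E) (Z₁ Z₂ : Set V) :
    N.spanFrom (F := F) h P (Z₁ ∪ Z₂) = N.spanFrom h P Z₁ ⊔ N.spanFrom h P Z₂ := by
  unfold spanFrom
  rw [← Submodule.span_union, ← Set.image_union]
  congr 2
  ext p
  simp only [Set.mem_union, Set.mem_ofPred_eq]
  tauto

theorem spanFrom_mono (h : E → M) (P : Finset E) {Z₁ Z₂ : Set V} (hZ : Z₁ ⊆ Z₂) :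
    N.spanFrom (F := F) h P Z₁ ≤ N.spanFrom h P Z₂ :=
  Submodule.span_mono (Set.image_mono fun _ hp => ⟨hp.1, hZ hp.2⟩)

/-- The number of unprocessed edges leaving `Z` plus the dimension spanned by the processed edges
starting in `Z`. -/
noncomputable def cutRank [Fintype E] (F : Type*) {M : Type*} [Field F] [AddCommGroup M]
    [Module F M] (h : E → M) (P : Finset E) (Z : Set V) : ℕ :=
  (N.crossing P Z).card + Module.finrank F (N.spanFrom (F := F) h P Z)

variable [FiniteDimensional F M]

/-- Submodularity: the span from a union is the sum of the spans, and the span from an intersection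
lies in their intersection. -/
theorem cutRank_union_add_inter_le [Fintype E] (h : E → M) (P : Finset E) (Z₁ Z₂ : Set V) :
    N.cutRank F h P (Z₁ ∪ Z₂) + N.cutRank F h P (Z₁ ∩ Z₂) ≤
      N.cutRank F h P Z₁ + N.cutRank F h P Z₂ := by
  have h1 := N.card_crossing_union_add_inter_le P Z₁ Z₂
  have h2 := Submodule.finrank_sup_add_finrank_inf_eq
    (N.spanFrom (F := F) h P Z₁) (N.spanFrom h P Z₂)
  have h3 := Submodule.finrank_mono (le_inf
    (N.spanFrom_mono (F := F) h P (Set.inter_subset_left (s := Z₁) (t := Z₂)))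
    (N.spanFrom_mono (F := F) h P Set.inter_subset_right))
  unfold cutRank
  rw [spanFrom_union]
  omega

/-- The vectors of the edges in `P` are combinations of the vectors of the following edges, and
every cut between a source and the sink keeps rank at least `R`. -/
structure IsPartialMulticast [Fintype E] (F : Type*) {M : Type*} [Field F] [AddCommGroup M]
    [Module F M] (h : E → M) (P : Finset E) (R : ℕ) : Prop where
  closed : ∀ p ∈ P, N.head p ≠ N.sink → ∀ f, N.tail f = N.head p → f ∈ P
  mem_span : ∀ p ∈ P, N.head p ≠ N.sink →
    h p ∈ Submodule.span F (h '' {f | N.tail f = N.head p})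
  le_cutRank : ∀ i, ∀ Z : Set V, N.source i ∈ Z → N.sink ∉ Z → R ≤ N.cutRank F h P Z

variable {N}

/-- The tight cuts crossed by `e` of one source have a largest member, and it does not contain
all vectors available for `e`. -/
theorem IsPartialMulticast.exists_tight_bound [Finite V] [Fintype E] {h : E → M} {P : Finset E}
    {R : ℕ} (hP : N.IsPartialMulticast F h P R) (hM : R = Module.finrank F M) {e : E} (he : e ∉ P)
    (hsucc : ∀ f, N.tail f = N.head e → f ∈ P) {W : Submodule F M}
    (hW : N.head e = N.sink → W = ⊤)
    (hW' : N.head e ≠ N.sink → W = Submodule.span F (h '' {f | N.tail f = N.head e})) (i : Fin s)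
    (hex : ∃ Z : Set V, N.source i ∈ Z ∧ N.sink ∉ Z ∧ N.tail e ∈ Z ∧ N.head e ∉ Z ∧
      N.cutRank F h P Z = R) :
    ∃ U : Submodule F M, ¬ W ≤ U ∧
      ∀ Z : Set V, N.source i ∈ Z ∧ N.sink ∉ Z ∧ N.tail e ∈ Z ∧ N.head e ∉ Z ∧
        N.cutRank F h P Z = R → N.spanFrom h P Z ≤ U := by
  obtain ⟨Z, ⟨hi, hs, ht, hh, hR⟩, hmax⟩ := (Set.toFinite {Z : Set V | N.source i ∈ Z ∧
    N.sink ∉ Z ∧ N.tail e ∈ Z ∧ N.head e ∉ Z ∧ N.cutRank F h P Z = R}).exists_maximal hex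
  refine ⟨N.spanFrom h P Z, fun hle => ?_, ?_⟩
  · have hcross : e ∈ N.crossing P Z := N.mem_crossing.2 ⟨he, ht, hh⟩
    have hpos : 0 < (N.crossing P Z).card := Finset.card_pos.2 ⟨e, hcross⟩
    unfold cutRank at hR
    by_cases hsink : N.head e = N.sink
    · rw [hW hsink, top_le_iff] at hle
      rw [hle, finrank_top] at hR
      omega
    · rw [hW' hsink] at hle
      -- If `W` lay in the span from `Z`, adding `head e` would leave the span unchanged and remove
      -- `e` from the crossing. No unprocessed edge is gained, since all edges leaving `head e` are
      -- processed, so the rank would drop below `R`.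
      have h1 := hP.le_cutRank i (Z ∪ {N.head e}) (Or.inl hi)
        (by rintro (h | h); exacts [hs h, hsink h.symm])
      have h2 : N.spanFrom h P (Z ∪ {N.head e}) ≤ N.spanFrom (F := F) h P Z := by
        rw [spanFrom_union]
        refine sup_le le_rfl (le_trans (Submodule.span_mono (Set.image_mono ?_)) hle)
        exact fun f hf => hf.2
      have h3 : N.crossing P (Z ∪ {N.head e}) ⊂ N.crossing P Z := by
        refine Finset.ssubset_iff_subset_ne.2 ⟨fun f hf => ?_, fun heq => ?_⟩
        · obtain ⟨hf1, hf2 | hf2, hf3⟩ := N.mem_crossing.1 hf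
          · exact N.mem_crossing.2 ⟨hf1, hf2, fun h => hf3 (Or.inl h)⟩
          · exact absurd (hsucc f hf2) hf1
        · rw [← heq] at hcross
          exact (N.mem_crossing.1 hcross).2.2 (Or.inr rfl)
      have h4 := Finset.card_lt_card h3
      have h5 := Submodule.finrank_mono h2
      unfold cutRank at h1
      omega
  · rintro Z' ⟨hi', hs', ht', hh', hR'⟩
    -- Unions of tight cuts are tight, by submodularity and the lower bound on the intersection.
    have h1 := N.cutRank_union_add_inter_le (F := F) h P Z Z'
    have h2 := hP.le_cutRank i (Z ∩ Z') ⟨hi, hi'⟩ (fun h => hs h.1)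
    have h3 := hP.le_cutRank i (Z ∪ Z') (Or.inl hi) (by rintro (h | h); exacts [hs h, hs' h])
    have hle := hmax (y := Z ∪ Z') ⟨Or.inl hi, by rintro (h | h); exacts [hs h, hs' h], Or.inl ht,
      by rintro (h | h); exacts [hh h, hh' h], by omega⟩ Set.subset_union_left
    exact N.spanFrom_mono h P (Set.subset_union_right.trans hle)

/-- Each source forbids at most one subspace for the vector of `e`, the span from its largest tight
cut crossed by `e`; hence `s < q` suffices. -/
theorem IsPartialMulticast.exists_insert [Finite V] [Fintype E] [Fintype F] [DecidableEq E]
    {h : E → M} {P : Finset E} {R : ℕ} (hP : N.IsPartialMulticast F h P R)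
    (hM : R = Module.finrank F M) (hq : s < Fintype.card F) {e : E} (he : e ∉ P)
    (hsucc : ∀ f, N.tail f = N.head e → f ∈ P) :
    ∃ h' : E → M, N.IsPartialMulticast F h' (insert e P) R := by
  obtain ⟨W, hW, hW'⟩ : ∃ W : Submodule F M, (N.head e = N.sink → W = ⊤) ∧
      (N.head e ≠ N.sink → W = Submodule.span F (h '' {f | N.tail f = N.head e})) := by
    by_cases hsink : N.head e = N.sink
    · exact ⟨⊤, fun _ => rfl, fun h => absurd hsink h⟩
    · exact ⟨_, fun h => absurd h hsink, fun _ => rfl⟩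
  let J := {i : Fin s // ∃ Z : Set V, N.source i ∈ Z ∧ N.sink ∉ Z ∧ N.tail e ∈ Z ∧ N.head e ∉ Z ∧
    N.cutRank F h P Z = R}
  choose U hWU hU using fun i : J => hP.exists_tight_bound hM he hsucc hW hW' i.1 i.2
  obtain ⟨v, hvW, hv⟩ := Submodule.exists_mem_forall_notMem W U hWU
    ((Finite.card_subtype_le _).trans_lt (by simpa using hq))
  have hne : ∀ p ∈ P, p ≠ e := fun p hp h => he (h ▸ hp)
  have hcl : ∀ p ∈ insert e P, N.head p ≠ N.sink → ∀ f, N.tail f = N.head p → f ∈ P := by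
    intro p hp hsink
    rcases Finset.mem_insert.1 hp with rfl | hp
    · exact hsucc
    · exact hP.closed p hp hsink
  have hle : ∀ Z, N.spanFrom (F := F) h P Z ≤
      N.spanFrom (Function.update h e v) (insert e P) Z := by
    refine fun Z => Submodule.span_mono ?_
    rintro _ ⟨p, ⟨hp, hpZ⟩, rfl⟩
    exact ⟨p, ⟨Finset.mem_insert_of_mem hp, hpZ⟩, Function.update_of_ne (hne p hp) _ _⟩
  refine ⟨Function.update h e v, fun p hp hsink f hf =>
    Finset.mem_insert_of_mem (hcl p hp hsink f hf), fun p hp hsink => ?_, fun i Z hi hs => ?_⟩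
  · have : Function.update h e v '' {f | N.tail f = N.head p} =
        h '' {f | N.tail f = N.head p} :=
      Set.image_congr fun f hf => Function.update_of_ne (hne f (hcl p hp hsink f hf)) _ _
    rw [this]
    rcases Finset.mem_insert.1 hp with rfl | hp
    · rw [Function.update_self, ← hW' hsink]
      exact hvW
    · rw [Function.update_of_ne (hne p hp)]
      exact hP.mem_span p hp hsink
  · have hR := hP.le_cutRank i Z hi hs
    have hfin := Submodule.finrank_mono (hle Z)
    have hsub : N.crossing P Z ⊆ insert e (N.crossing (insert e P) Z) := by
      intro f hf
      by_cases hfe : f = e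
      · exact hfe ▸ Finset.mem_insert_self _ _
      · obtain ⟨h1, h2⟩ := N.mem_crossing.1 hf
        exact Finset.mem_insert_of_mem (N.mem_crossing.2 ⟨by simp [hfe, h1], h2⟩)
    by_cases hcr : N.tail e ∈ Z ∧ N.head e ∉ Z
    · have hcard := (Finset.card_le_card hsub).trans (Finset.card_insert_le _ _)
      -- Processing `e` costs one crossing edge. A tight cut regains it because `v` enlarges the
      -- span; any other cut has a unit to spare.
      by_cases htight : N.cutRank F h P Z = R
      · have hZ : N.source i ∈ Z ∧ N.sink ∉ Z ∧ N.tail e ∈ Z ∧ N.head e ∉ Z ∧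
          N.cutRank F h P Z = R := ⟨hi, hs, hcr.1, hcr.2, htight⟩
        have hvZ : v ∉ N.spanFrom (F := F) h P Z :=
          fun hmem => hv ⟨i, Z, hZ⟩ (hU ⟨i, Z, hZ⟩ Z hZ hmem)
        have hvZ' : v ∈ N.spanFrom (F := F) (Function.update h e v) (insert e P) Z :=
          Submodule.subset_span
            ⟨e, ⟨Finset.mem_insert_self _ _, hcr.1⟩, Function.update_self _ _ _⟩
        have hlt := Submodule.finrank_lt_finrank_of_lt
          (lt_of_le_of_ne (hle Z) fun heq => hvZ (heq ▸ hvZ'))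
        unfold cutRank at hR ⊢
        omega
      · unfold cutRank at hR htight ⊢
        omega
    · have hsub' : N.crossing P Z ⊆ N.crossing (insert e P) Z := by
        intro f hf
        rcases Finset.mem_insert.1 (hsub hf) with rfl | hf'
        · exact absurd (N.mem_crossing.1 hf).2 hcr
        · exact hf'
      have hcard := Finset.card_le_card hsub'
      unfold cutRank at hR ⊢
      omega

variable (N)

/-- A linear multicast from the sink to all source nodes in the reversed network. -/
theorem exists_multicast [Finite V] [Fintype E] [Fintype F] (hq : s < Fintype.card F)
    (hR : Module.finrank F M ≤ N.cMin) :
    ∃ h : E → M, (∀ e, N.head e ≠ N.sink →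
        h e ∈ Submodule.span F (h '' {f | N.tail f = N.head e})) ∧
      ∀ i, Submodule.span F (h '' {e | N.tail e = N.source i}) = ⊤ := by
  classical
  have key : ∀ n (P : Finset E), Pᶜ.card = n →
      (∃ h : E → M, N.IsPartialMulticast F h P (Module.finrank F M)) →
      ∃ h : E → M, N.IsPartialMulticast F h Finset.univ (Module.finrank F M) := by
    intro n
    induction n with
    | zero =>
      intro P hP h
      rw [Finset.card_eq_zero, Finset.compl_eq_empty_iff] at hP
      subst hP
      exact h
    | succ n ih =>
      rintro P hP ⟨h, hh⟩
      have hne : {e | e ∉ P}.Nonempty := by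
        have : Pᶜ.Nonempty := Finset.card_pos.1 (by omega)
        obtain ⟨e, he⟩ := this
        exact ⟨e, Finset.mem_compl.1 he⟩
      -- Edges are processed from the sink backwards.
      obtain ⟨e, he, hmin⟩ := N.wellFounded_edges_flip.has_min _ hne
      have hsucc : ∀ f, N.tail f = N.head e → f ∈ P := by
        intro f hf
        by_contra hfP
        exact hmin f hfP hf.symm
      refine ih (insert e P) ?_ (hh.exists_insert rfl hq he hsucc)
      rw [Finset.compl_insert, Finset.card_erase_of_mem (Finset.mem_compl.2 he), hP]
      rfl
  obtain ⟨h, hh⟩ := key _ ∅ rfl ⟨0, fun p hp => absurd hp (Finset.notMem_empty _),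
    fun p hp => absurd hp (Finset.notMem_empty _), fun i Z hi hs =>
      (hR.trans (N.cMin_le_card_crossing hi hs)).trans (Nat.le_add_right _ _)⟩
  refine ⟨h, fun e => hh.mem_span e (Finset.mem_univ e), fun i => ?_⟩
  -- With no unprocessed edge left, the rank of this cut is the dimension spanned at the source.
  have hcut := hh.le_cutRank i {N.source i} rfl (fun h => N.source_ne_sink i h.symm)
  have hzero : N.crossing Finset.univ {N.source i} = ∅ := by
    ext f
    simp [mem_crossing]
  unfold cutRank at hcut
  rw [hzero, Finset.card_empty, zero_add] at hcut
  have hspan : N.spanFrom (F := F) h Finset.univ {N.source i} =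
      Submodule.span F (h '' {e | N.tail e = N.source i}) := by
    simp [spanFrom]
  rw [← hspan]
  exact Submodule.eq_top_of_finrank_eq (le_antisymm (Submodule.finrank_le _) hcut)

end Multicast

end Network

/-! ### Zero mutual information. -/

section Information

theorem PMF.sum_toReal {α : Type*} [Fintype α] (q : PMF α) : ∑ a, (q a).toReal = 1 := by
  rw [← ENNReal.toReal_sum fun a _ => q.apply_ne_top a, ← tsum_fintype (L := .unconditional α),
    q.tsum_coe, ENNReal.toReal_one]

theorem mutualInfo_eq_zero_of_map_prod {Ω α β : Type*} [Fintype α] [Fintype β] (p : PMF Ω)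
    (X : Ω → α) (Y : Ω → β)
    (h : ∀ a b, p.map (fun ω => (X ω, Y ω)) (a, b) = p.map X a * p.map Y b) :
    mutualInfo p X Y = 0 := by
  unfold mutualInfo shannonEntropy
  rw [Fintype.sum_prod_type]
  simp_rw [h, ENNReal.toReal_mul, Real.negMulLog_mul, Finset.sum_add_distrib, ← Finset.mul_sum,
    ← Finset.sum_mul, PMF.sum_toReal, one_mul]
  ring

theorem map_uniformOfFintype_apply {Ω α : Type*} [Fintype Ω] [Nonempty Ω] [DecidableEq α]
    (X : Ω → α) (a : α) :
    (PMF.uniformOfFintype Ω).map X a =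
      ((Finset.univ.filter fun ω => X ω = a).card : ENNReal) / Fintype.card Ω := by
  classical
  rw [PMF.map_apply, tsum_fintype]
  simp_rw [PMF.uniformOfFintype_apply, eq_comm (a := a)]
  rw [← Finset.sum_filter, Finset.sum_const, nsmul_eq_mul, ENNReal.div_eq_inv_mul, mul_comm]

/-- If for every message there is a key, depending only on the message, by which the observation
can be shifted so as to cancel the message, the observation reveals nothing about the message. -/
theorem mutualInfo_eq_zero_of_shift {M K α β : Type*} [Fintype M] [Fintype K] [Nonempty M]
    [Nonempty K] [AddGroup K] [Fintype α] [Fintype β] (X : M × K → α) (Y : M → β) (u : K → α)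
    (κ : M → K) (hX : ∀ m k, X (m, k + κ m) = u k) :
    mutualInfo (PMF.uniformOfFintype (M × K)) X (fun x => Y x.1) = 0 := by
  classical
  -- This bijection fixes the message and makes the observation a function of the key alone, so the
  -- joint counts factor.
  let σ : M × K ≃ M × K := Equiv.prodShear (Equiv.refl M) fun m => Equiv.addRight (κ m)
  have hXσ : ∀ ω, X (σ ω) = u ω.2 := fun ω => hX ω.1 ω.2
  have h0 : (Fintype.card M : ENNReal) ≠ 0 := by simp
  have h0' : (Fintype.card K : ENNReal) ≠ 0 := by simp
  refine mutualInfo_eq_zero_of_map_prod _ _ _ fun a b => ?_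
  have c1 : (Finset.univ.filter fun ω : M × K => X ω = a).card =
      Fintype.card M * (Finset.univ.filter fun k => u k = a).card := by
    rw [Finset.card_equiv σ (s := Finset.univ.filter fun ω : M × K => u ω.2 = a) (fun ω => by
      simp [hXσ]) |>.symm, ← Finset.card_univ, ← Finset.card_product]
    congr 1
    ext ω
    simp
  have c2 : (Finset.univ.filter fun ω : M × K => Y ω.1 = b).card =
      (Finset.univ.filter fun m => Y m = b).card * Fintype.card K := by
    rw [← Finset.card_univ, ← Finset.card_product]
    congr 1
    ext ω
    simp
  have c3 : (Finset.univ.filter fun ω : M × K => (X ω, Y ω.1) = (a, b)).card =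
      (Finset.univ.filter fun m => Y m = b).card * (Finset.univ.filter fun k => u k = a).card := by
    rw [Finset.card_equiv σ (s := Finset.univ.filter fun ω : M × K => Y ω.1 = b ∧ u ω.2 = a)
      (fun ω => by
        simp only [Finset.mem_filter, Finset.mem_univ, true_and, Prod.mk.injEq, hXσ]
        exact and_comm) |>.symm, ← Finset.card_product]
    congr 1
    ext ω
    simp
  rw [map_uniformOfFintype_apply, map_uniformOfFintype_apply, map_uniformOfFintype_apply, c1, c2,
    c3, Fintype.card_prod]
  push_cast
  rw [ENNReal.mul_div_mul_left _ _ h0 (by simp), ENNReal.mul_div_mul_right _ _ h0' (by simp)]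
  simp only [div_eq_mul_inv, ENNReal.mul_inv (Or.inl h0) (Or.inr h0')]
  ring

end Information

/-! ### Forward propagation and its transpose. -/

namespace Network

variable {V E : Type*} {s : ℕ} (N : Network V E s)

open Classical in
/-- Vectors on the edges, prescribed on the edges leaving a source and propagated linearly. -/
theorem exists_propagation [Fintype E] {F M : Type*} [Field F] [AddCommGroup M] [Module F M]
    (init : E → M) (L : E → E → F) :
    ∃ g : E → M, (∀ e, (∃ i, N.tail e = N.source i) → g e = init e) ∧
      ∀ e, (∀ i, N.tail e ≠ N.source i) →
        g e = ∑ d with N.head d = N.tail e, L d e • g d := by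
  refine ⟨N.wellFounded_edges.fix fun e y => if ∃ i, N.tail e = N.source i then init e else
    ∑ d : {d : E // N.head d = N.tail e}, L d.1 e • y d.1 d.2, fun e he => ?_, fun e he => ?_⟩
  · rw [WellFounded.fix_eq, if_pos he]
  · rw [WellFounded.fix_eq, if_neg (by simpa using he)]
    exact (Finset.sum_subtype _ (by simp) (fun d => L d e • WellFounded.fix _ _ d)).symm

open Classical in
/-- A functional killing the propagated vectors on a cut kills them beyond the cut. -/
theorem dotProduct_eq_zero_of_cut [Fintype E] {F : Type*} [Field F] {R : ℕ} {i : Fin s}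
    {L : E → E → F} {g : E → Fin R → F}
    (hsrc : ∀ e j, N.tail e = N.source j → j ≠ i → g e = 0)
    (hint : ∀ e, (∀ i, N.tail e ≠ N.source i) → g e = ∑ d with N.head d = N.tail e, L d e • g d)
    {B : Finset E} {x : Fin R → F} (hx : ∀ b ∈ B, x ⬝ᵥ g b = 0) (e : E)
    (he : ¬ N.NodeToEdge B (N.source i) e) : x ⬝ᵥ g e = 0 := by
  induction e using N.wellFounded_edges.induction with
  | _ e ih =>
    by_cases heB : e ∈ B
    · exact hx e heB
    by_cases hs : ∃ j, N.tail e = N.source j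
    · obtain ⟨j, hj⟩ := hs
      by_cases hji : j = i
      · subst hji
        exact absurd ⟨e, hj, heB, .refl⟩ he
      · rw [hsrc e j hj hji, dotProduct_zero]
    · push Not at hs
      rw [hint e hs, dotProduct_sum]
      refine Finset.sum_eq_zero fun d hd => ?_
      have hd := (Finset.mem_filter.1 hd).2
      rw [dotProduct_smul, ih d hd fun hp => he (hp.step hd heB), smul_zero]

open Classical in
/-- The symbols entering the sink carry the same combination as the symbols leaving the
sources. -/
theorem sum_smul_sink_eq_sum_smul_source [Fintype E] {F M : Type*} [Field F] [AddCommGroup M]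
    [Module F M] {L : E → E → F} {h : E → M} {y : E → F}
    (hh : ∀ d, N.head d ≠ N.sink → h d = ∑ e with N.tail e = N.head d, L d e • h e)
    (hy : ∀ e, (∀ i, N.tail e ≠ N.source i) → y e = ∑ d with N.head d = N.tail e, L d e * y d) :
    ∑ e with N.head e = N.sink, y e • h e =
      ∑ i, ∑ e with N.tail e = N.source i, y e • h e := by
  have h1 := Finset.sum_filter_add_sum_filter_not Finset.univ (fun e => N.head e = N.sink)
    (fun e => y e • h e)
  have h2 := Finset.sum_filter_add_sum_filter_not Finset.univ
    (fun e => ∃ i, N.tail e = N.source i) (fun e => y e • h e)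
  -- Both sides are the sum of `L d e * y d • h e` over consecutive edges `d`, `e`: the recursion
  -- for `h` expands one side, that for `y` the other.
  have h3 : ∑ e with ¬ N.head e = N.sink, y e • h e =
      ∑ e with ¬ ∃ i, N.tail e = N.source i, y e • h e := by
    calc ∑ d with ¬ N.head d = N.sink, y d • h d
        = ∑ d with ¬ N.head d = N.sink, ∑ e with N.tail e = N.head d, (L d e * y d) • h e := by
          refine Finset.sum_congr rfl fun d hd => ?_
          nth_rewrite 1 [hh d (Finset.mem_filter.1 hd).2]
          rw [Finset.smul_sum]
          exact Finset.sum_congr rfl fun e _ => by rw [smul_smul, mul_comm]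
      _ = ∑ e with ¬ ∃ i, N.tail e = N.source i, ∑ d with N.head d = N.tail e,
            (L d e * y d) • h e := by
          refine Finset.sum_comm' fun d e => ?_
          simp only [Finset.mem_filter, Finset.mem_univ, true_and, not_exists]
          constructor
          · rintro ⟨-, h⟩
            exact ⟨h.symm, fun i => h ▸ N.head_ne_source d i⟩
          · rintro ⟨h, -⟩
            exact ⟨h ▸ N.tail_ne_sink e, h.symm⟩
      _ = _ := by
          refine Finset.sum_congr rfl fun e he => ?_
          rw [← Finset.sum_smul, ← hy e (by simpa using he)]
  have h4 : ∑ e with ∃ i, N.tail e = N.source i, y e • h e =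
      ∑ i, ∑ e with N.tail e = N.source i, y e • h e := by
    rw [← Finset.sum_biUnion]
    · congr 1
      ext e
      simp
    · intro i _ j _ hij
      refine Finset.disjoint_left.2 fun e hi hj => hij ?_
      exact N.source_injective
        ((Finset.mem_filter.1 hi).2.symm.trans (Finset.mem_filter.1 hj).2)
  rw [h3] at h1
  rw [← h4]
  exact add_right_cancel (h1.trans h2.symm)

end Network

theorem exists_coeff_of_mem_span_image {F M E : Type*} [Field F] [AddCommGroup M] [Module F M]
    [Fintype E] {h : E → M} {p : E → Prop} [DecidablePred p] {x : M}
    (hx : x ∈ Submodule.span F (h '' {f | p f})) : ∃ c : E → F, x = ∑ f with p f, c f • h f := by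
  have : {f | p f} = ((Finset.univ.filter p : Finset E) : Set E) := by
    ext
    simp
  rw [this, Submodule.mem_span_image_finset_iff_exists_fun'] at hx
  obtain ⟨c, hc⟩ := hx
  exact ⟨c, hc.symm⟩

/-- The subspace of vectors orthogonal to `r` given vectors has codimension at most `r`. -/
theorem exists_submodule_orthogonal {F E : Type*} [Field F] {R : ℕ} (g : E → Fin R → F)
    (B : Finset E) :
    ∃ G : Submodule F (Fin R → F), (∀ x ∈ G, ∀ b ∈ B, x ⬝ᵥ g b = 0) ∧
      Module.finrank F (Fin R → F) ≤ Module.finrank F G + B.card := by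
  let φ : (Fin R → F) →ₗ[F] (B → F) := LinearMap.pi fun b =>
    (dotProductBilin F F).flip (g b)
  refine ⟨LinearMap.ker φ, fun x hx b hb => congrFun (LinearMap.mem_ker.1 hx) ⟨b, hb⟩, ?_⟩
  have h1 := LinearMap.finrank_range_add_finrank_ker φ
  have h2 := (LinearMap.range φ).finrank_le
  rw [Module.finrank_fintype_fun_eq_card, Fintype.card_coe] at h2
  omega

/-! ### The column code: correctness and security. -/

/-- The code that runs one scalar network code for every column of `T`, the source `i` feeding the
coordinates of its message and key with respect to `b` into it, scaled by the entries of `T`. -/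
noncomputable def columnCode {V E F : Type*} [Field F] [Fintype E] {s k l m R : ℕ}
    (N : Network V E s) (T : Matrix (Fin s) (Fin k) F) (a : Fin s → E → Fin R → F)
    (L : E → E → F) (h : E → Fin R → F) (b : Module.Basis (Fin l ⊕ Fin m) F (Fin R → F)) :
    LinearSecureCode N F (Fin k → F) l k where
  keyLen _ := m
  srcMat i e := Matrix.of fun u j => T i j * (b u ⬝ᵥ a i e)
  intMat d e := L d e • (1 : Matrix (Fin k) (Fin k) F)
  decode y u j := by
    classical
    exact b.repr (∑ e : {e : E // N.head e = N.sink}, y e j • h e) (Sum.inl u)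

namespace columnCode

variable {V E F : Type*} [Field F] [Fintype E] {s k l m R : ℕ}
    {N : Network V E s} {T : Matrix (Fin s) (Fin k) F} {a : Fin s → E → Fin R → F}
    {L : E → E → F} {h : E → Fin R → F} {b : Module.Basis (Fin l ⊕ Fin m) F (Fin R → F)}

/-- The vector that the source `i` feeds into the scalar network code. -/
noncomputable def input (b : Module.Basis (Fin l ⊕ Fin m) F (Fin R → F)) (μ : Fin l → F)
    (κ : Fin m → F) : Fin R → F :=
  ∑ u, Sum.elim μ κ u • b u

theorem input_add (μ μ' : Fin l → F) (κ κ' : Fin m → F) :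
    input b (μ + μ') (κ + κ') = input b μ κ + input b μ' κ' := by
  simp [input, Fintype.sum_sum_type, add_smul, Finset.sum_add_distrib]
  abel

theorem repr_input (μ : Fin l → F) (κ : Fin m → F) (u : Fin l ⊕ Fin m) :
    b.repr (input b μ κ) u = Sum.elim μ κ u := by
  rw [input, b.repr_sum_self]

theorem globalEnc_source (x : (columnCode N T a L h b).Realization) {e : E} {i : Fin s}
    (he : N.tail e = N.source i) (j : Fin k) :
    (columnCode N T a L h b).globalEnc x e j = T i j * (input b (x.1 i) (x.2 i) ⬝ᵥ a i e) := by
  rw [LinearSecureCode.globalEnc_of_source _ _ _ i he]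
  simp only [Matrix.vecMul, dotProduct, columnCode, input, Matrix.of_apply, Finset.mul_sum,
    Finset.sum_apply, Pi.smul_apply, smul_eq_mul, Finset.sum_mul]
  rw [Finset.sum_comm]
  refine Finset.sum_congr rfl fun w _ => Finset.sum_congr rfl fun u _ => ?_
  ring

open Classical in
theorem globalEnc_inner (x : (columnCode N T a L h b).Realization) {e : E}
    (he : ∀ i, N.tail e ≠ N.source i) (j : Fin k) :
    (columnCode N T a L h b).globalEnc x e j =
      ∑ d with N.head d = N.tail e, L d e * (columnCode N T a L h b).globalEnc x d j := by
  rw [LinearSecureCode.globalEnc_of_not_source _ _ _ he, Finset.sum_apply]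
  rw [Finset.sum_subtype (p := fun d => N.head d = N.tail e) _ (by simp)]
  refine Finset.sum_congr rfl fun d _ => ?_
  change Matrix.vecMul _ (L d e • (1 : Matrix (Fin k) (Fin k) F)) j = _
  rw [Matrix.vecMul_smul, Matrix.vecMul_one]
  rfl

open Classical in
-- The column index enters only through `T i j`; the scalars `input ⬝ᵥ g i e` are common to all
-- columns.
theorem globalEnc_eq {g : Fin s → E → Fin R → F}
    (hsrc : ∀ i e, (∃ j, N.tail e = N.source j) →
      g i e = if N.tail e = N.source i then a i e else 0)
    (hint : ∀ i e, (∀ j, N.tail e ≠ N.source j) →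
      g i e = ∑ d with N.head d = N.tail e, L d e • g i d)
    (x : (columnCode N T a L h b).Realization) (e : E) (j : Fin k) :
    (columnCode N T a L h b).globalEnc x e j =
      ∑ i, T i j * (input b (x.1 i) (x.2 i) ⬝ᵥ g i e) := by
  induction e using N.wellFounded_edges.induction with
  | _ e ih =>
    by_cases hs : ∃ i, N.tail e = N.source i
    · obtain ⟨i, hi⟩ := hs
      rw [globalEnc_source x hi, Finset.sum_eq_single i]
      · rw [hsrc i e ⟨i, hi⟩, if_pos hi]
      · intro i' _ hne
        rw [hsrc i' e ⟨i, hi⟩, if_neg fun h' => hne (N.source_injective (h'.symm.trans hi)),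
          dotProduct_zero, mul_zero]
      · simp
    · push Not at hs
      rw [globalEnc_inner x hs]
      simp_rw [hint _ e hs, dotProduct_sum, Finset.mul_sum]
      rw [Finset.sum_comm]
      refine Finset.sum_congr rfl fun d hd => ?_
      rw [ih d (Finset.mem_filter.1 hd).2, Finset.mul_sum]
      refine Finset.sum_congr rfl fun i _ => ?_
      rw [dotProduct_smul, smul_eq_mul]
      ring

open Classical in
theorem computes (hh : ∀ d, N.head d ≠ N.sink → h d = ∑ e with N.tail e = N.head d, L d e • h e)
    (ha : ∀ i x, ∑ e with N.tail e = N.source i, (x ⬝ᵥ a i e) • h e = x) :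
    (columnCode N T a L h b).Computes (fun m => Matrix.vecMul m T) := by
  intro x
  funext u j
  have hsum := N.sum_smul_sink_eq_sum_smul_source hh
    (y := fun e => (columnCode N T a L h b).globalEnc x e j) fun e he => globalEnc_inner x he j
  have hsrc : ∀ i, ∑ e with N.tail e = N.source i,
      (columnCode N T a L h b).globalEnc x e j • h e = T i j • input b (x.1 i) (x.2 i) := by
    intro i
    have key : ∀ v, ∑ e with N.tail e = N.source i, (T i j * (v ⬝ᵥ a i e)) • h e = T i j • v := by
      intro v
      nth_rewrite 2 [← ha i v]
      simp_rw [Finset.smul_sum, smul_smul]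
    refine Eq.trans (Finset.sum_congr rfl fun e he => ?_) (key _)
    rw [globalEnc_source x (Finset.mem_filter.1 he).2]
  simp_rw [hsrc] at hsum
  rw [Finset.sum_subtype (p := fun e => N.head e = N.sink) _ (by simp)] at hsum
  change b.repr (∑ e : {e : E // N.head e = N.sink},
    (columnCode N T a L h b).globalEnc x e j • h e) (Sum.inl u) = _
  rw [hsum, map_sum, Finsupp.finsetSum_apply]
  have hrepr : ∀ i, b.repr (input b (x.1 i) (x.2 i)) (Sum.inl u) = x.1 i u :=
    fun i => repr_input _ _ _
  simp [hrepr, Matrix.vecMul, dotProduct, mul_comm]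

/-- The key subtracts the component of the message vector along the key vectors, leaving its
component in `G`. -/
theorem exists_key {G : Submodule F (Fin R → F)}
    (hG : Submodule.span F (Set.range fun u => b (Sum.inr u)) ⊔ G = ⊤) (μ : Fin l → F) :
    ∃ κ : Fin m → F, input b μ κ ∈ G := by
  have hmem : input b μ 0 ∈ Submodule.span F (Set.range fun u => b (Sum.inr u)) ⊔ G :=
    hG ▸ Submodule.mem_top
  obtain ⟨y, hy, z, hz, hyz⟩ := Submodule.mem_sup.1 hmem
  obtain ⟨c, rfl⟩ := (Submodule.mem_span_range_iff_exists_fun F).1 hy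
  refine ⟨-c, ?_⟩
  have h1 : input b 0 (-c) = -∑ u, c u • b (Sum.inr u) := by
    simp [input, Fintype.sum_sum_type]
  have h2 := input_add (b := b) μ 0 0 (-c)
  rw [add_zero, zero_add] at h2
  rw [h2, h1, ← hyz, add_comm, neg_add_cancel_left]
  exact hz

open Classical in
theorem isSecure [Fintype F] {Q : Type*} [Fintype Q] {g : Fin s → E → Fin R → F}
    (hsrc : ∀ i e, (∃ j, N.tail e = N.source j) →
      g i e = if N.tail e = N.source i then a i e else 0)
    (hint : ∀ i e, (∀ j, N.tail e ≠ N.source j) →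
      g i e = ∑ d with N.head d = N.tail e, L d e • g i d)
    {𝒲 : Set (Finset E)} (ζ : (Fin s → F) → Q)
    (h𝒲 : ∀ W ∈ 𝒲, ∀ i, ∃ G : Submodule F (Fin R → F),
      Submodule.span F (Set.range fun u => b (Sum.inr u)) ⊔ G = ⊤ ∧
        ∀ x ∈ G, ∀ e ∈ W, x ⬝ᵥ g i e = 0) :
    (columnCode N T a L h b).IsSecure 𝒲 ζ := by
  intro W hW
  choose G hG hGW using h𝒲 W hW
  choose κ hκ using fun i => exists_key (hG i)
  refine mutualInfo_eq_zero_of_shift (M := Fin s → Fin l → F) (K := Fin s → Fin m → F)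
    (fun x (e : {e : E // e ∈ W}) => (columnCode N T a L h b).globalEnc x e.1)
    (fun x (j : Fin l) => ζ fun i => x i j)
    (fun k e => (columnCode N T a L h b).globalEnc (0, k) e.1)
    -- Each source cancels its own message, so the shift uses only local keys.
    (fun μ i => κ i (μ i)) fun μ k => ?_
  funext e j
  refine (globalEnc_eq hsrc hint _ _ _).trans
    (Eq.trans (Finset.sum_congr rfl fun i _ => ?_) (globalEnc_eq hsrc hint _ _ _).symm)
  have h1 := input_add (b := b) 0 (μ i) (k i) (κ i (μ i))
  rw [zero_add] at h1
  change T i j * (input b (μ i) (k i + κ i (μ i)) ⬝ᵥ g i e) = T i j * (input b 0 (k i) ⬝ᵥ g i e)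
  rw [h1, add_dotProduct, hGW i _ (hκ i (μ i)) e e.2, add_zero]

end columnCode

/-! ### Assembly of the code. -/

theorem mainTheorem7 {V E F : Type*} [Finite V] [Fintype E] [Field F] [Fintype F]
    {s k t : ℕ} (hs : 0 < s) (hk : 0 < k) (N : Network V E s)
    (T : Matrix (Fin s) (Fin k) F) (Υ : Matrix (Fin s) (Fin t) F)
    (r R : ℕ) (hrR : r * k ≤ R) (hR : R ≤ N.cMin)
    (hq : s * (N.wBottomExact r).ncard < Fintype.card F) :
    ∃ c : LinearSecureCode N F (Fin k → F) (R - r * k) k,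
      c.Admissible (fun m => Matrix.vecMul m T) (N.wiretapSets r)
        (fun m => Matrix.vecMul m Υ) := by
  classical
  have hrk : r ≤ r * k := Nat.le_mul_of_pos_right r hk
  have hrC : r ≤ N.cMin := (hrk.trans hrR).trans hR
  -- The wiretap set `∅` already yields a bottom element with `r` edges, so the product in `hq` is
  -- at least `s`.
  have hsq : s < Fintype.card F := by
    obtain ⟨B, hB, -⟩ := N.exists_mem_wBottomExact hs hrC (W := ∅) (Nat.zero_le _)
    have hpos : 0 < (N.wBottomExact r).ncard := (Set.ncard_pos (Set.toFinite _)).2 ⟨B, hB⟩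
    exact (Nat.le_mul_of_pos_right s hpos).trans_lt hq
  obtain ⟨h, hh, hspan⟩ := N.exists_multicast (F := F) (M := Fin R → F) hsq (by simpa using hR)
  have hL : ∀ d, ∃ c : E → F, N.head d ≠ N.sink →
      h d = ∑ e with N.tail e = N.head d, c e • h e := by
    intro d
    by_cases hd : N.head d = N.sink
    · exact ⟨0, fun h => absurd hd h⟩
    · obtain ⟨c, hc⟩ := exists_coeff_of_mem_span_image (hh d hd)
      exact ⟨c, fun _ => hc⟩
  choose L hL using hL
  have ha : ∀ (i : Fin s) (w : Fin R), ∃ c : E → F,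
      (Pi.single w 1 : Fin R → F) = ∑ e with N.tail e = N.source i, c e • h e :=
    fun i w => exists_coeff_of_mem_span_image (hspan i ▸ Submodule.mem_top)
  choose a ha using ha
  have ha' : ∀ i (x : Fin R → F),
      ∑ e with N.tail e = N.source i, (x ⬝ᵥ fun w => a i w e) • h e = x := by
    intro i x
    conv_rhs => rw [pi_eq_sum_univ' x]
    simp_rw [dotProduct, Finset.sum_smul]
    rw [Finset.sum_comm]
    refine Finset.sum_congr rfl fun w _ => ?_
    simp_rw [mul_smul]
    rw [← Finset.smul_sum, ← ha i w]
  choose g hsrc hint using fun i : Fin s => N.exists_propagation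
    (fun e => if N.tail e = N.source i then fun w => a i w e else (0 : Fin R → F)) L
  choose G hG hGr using fun p : Fin s × N.wBottomExact r =>
    exists_submodule_orthogonal (g p.1) p.2.1
  -- The index set consists of the pairs of a source and a bottom element, which `hq` counts. The
  -- codimension bound is `r`, which is at most the key length `r * k`.
  obtain ⟨b, hb⟩ := exists_basis_forall_span_sup_eq_top (l := R - r * k) (m := r * k)
    (by rwa [Nat.card_prod, Nat.card_fin, Nat.card_coe_set_eq]) (by simp; omega) hrk G
    (fun p => by simpa only [p.2.2.2] using hGr p)
  refine ⟨columnCode N T (fun i e w => a i w e) L h b, columnCode.computes hL ha',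
    columnCode.isSecure hsrc hint _ fun W hW i => ?_⟩
  obtain ⟨B, hB, hcut⟩ := N.exists_mem_wBottomExact hs hrC hW
  refine ⟨G (i, ⟨B, hB⟩), hb _, fun x hx e he => ?_⟩
  refine N.dotProduct_eq_zero_of_cut (fun e j hj hji => ?_) (hint i)
    (hG (i, ⟨B, hB⟩) x hx) e (hcut i e he)
  rw [hsrc i e ⟨j, hj⟩, if_neg fun h' => hji (N.source_injective (hj.symm.trans h'))]
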